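/- Let $\mathbb{K}$ be an algebraically closed field and let $V$ be a vector space over $\mathbb{K}$ of finite positive dimension. A linear map $V\to V$ is diagonalizable if its eigenspaces span $V$. A *tridiagonal pair* on $V$ is an ordered pair of diagonalizable linear maps $A,A^*:V\to V$ such that: the eigenspaces of $A$ can be ordered $V_0,\dots,V_d$ with $A^*V_i\subseteq V_{i-1}+V_i+V_{i+1}$ for $0\le i\le d$ (where $V_{-1}=V_{d+1}=0$); the eigenspaces of $A^*$ can be ordered $V_0^*,\dots,V_\delta^*$ with $AV_i^*\subseteq V_{i-1}^*+V_i^*+V_{i+1}^*$ for $0\le i\le\delta$ (where $V^*_{-1}=V^*_{\delta+1}=0$); and no subspace $W$ of $V$ other than $0$ and $V$ satisfies $AW\subseteq W$ and $A^*W\subseteq W$. Such orderings are called standard. A *tridiagonal system of diameter* $d$ on $V$ is a sequence $\Phi=(A;\{E_i\}_{i=0}^d;A^*;\{E_i^*\}_{i=0}^d)$ in which $A,A^*$ is a tridiagonal pair on $V$ and $E_0,\dots,E_d$ (resp. $E_0^*,\dots,E_d^*$) are the projections of $V$ onto the eigenspaces of $A$ (resp. $A^*$), along the sum of the other eigenspaces,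 taken in a standard ordering. Let $\Phi$ be a tridiagonal system on $V$ of diameter $d\ge 1$, and let $q,a,b\in\mathbb{K}$ be nonzero with $q^4\ne1$ such that for $0\le i\le d$ the eigenvalue of $A$ on $E_iV$ is $aq^{d-2i}+a^{-1}q^{2i-d}$ and the eigenvalue of $A^*$ on $E_i^*V$ is $bq^{d-2i}+b^{-1}q^{2i-d}$. For $0\le i\le d$ put $$U_i=(E_0^*V+\cdots+E_i^*V)\cap(E_iV+\cdots+E_dV),\qquad U_i^{\Downarrow}=(E_0^*V+\cdots+E_i^*V)\cap(E_0V+\cdots+E_{d-i}V),$$ and for $0\le i\le d/2$ put $$K_i=(E_0^*V+\cdots+E_i^*V)\cap(E_iV+\cdots+E_{d-i}V).$$ Then there is a unique linear map $K:V\to V$ that acts on $U_i$ as $q^{d-2i}I$ for $0\le i\le d$, there is a unique linear map $B:V\to V$ that acts on $U_i^{\Downarrow}$ as $q^{d-2i}I$ for $0\le i\le d$, and $K$ and $B$ are invertible. Put $R=A-aK-a^{-1}K^{-1}$. There is a unique linear map $\psi:V\to V$ such that $\psi R-R\psi=(q-q^{-1})(K-K^{-1})$ and $\psi K_i=0$ for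 $0\le i\le d/2$. For these maps, the following four operators are equal: $$(I-aq\psi)K,\qquad (I-a^{-1}q\psi)B,\qquad K(I-aq^{-1}\psi),\qquad B(I-a^{-1}q^{-1}\psi);$$ and the following four operators are equal: $$(I-a^{-1}q^{-1}\psi)K^{-1},\qquad (I-aq^{-1}\psi)B^{-1},\qquad K^{-1}(I-a^{-1}q\psi),\qquad B^{-1}(I-aq\psi).$$ -/

import Mathlib

/-- `W 0, …, W d` is an ordering of the eigenspaces of `A`: the list has no repetition, and its
members are exactly the nonzero subspaces of the form `{v | A v = θ v}`. -/
def IsEigenspaceOrdering {𝕂 V : Type*} [Field 𝕂] [AddCommGroup V] [Module 𝕂 V] {d : ℕ}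
    (A : Module.End 𝕂 V) (W : Fin (d + 1) → Submodule 𝕂 V) : Prop :=
  Function.Injective W ∧
    ∀ X : Submodule 𝕂 V, (∃ i, W i = X) ↔ X ≠ ⊥ ∧ ∃ θ : 𝕂, X = Module.End.eigenspace A θ

/-- A standard ordering of the eigenspaces of `A` with respect to `A'`:
`A' W_i ⊆ W_{i-1} + W_i + W_{i+1}` for `0 ≤ i ≤ d`, where `W_{-1} = W_{d+1} = 0`. -/
def IsStandardOrdering {𝕂 V : Type*} [Field 𝕂] [AddCommGroup V] [Module 𝕂 V] {d : ℕ}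
    (A A' : Module.End 𝕂 V) (W : Fin (d + 1) → Submodule 𝕂 V) : Prop :=
  IsEigenspaceOrdering A W ∧
    ∀ i : Fin (d + 1), (W i).map A' ≤
      ⨆ j : Fin (d + 1), ⨆ _ : (j : ℕ) ≤ i + 1 ∧ (i : ℕ) ≤ j + 1, W j

/-- Tridiagonal pairs on `V`. -/
structure IsTridiagonalPair {𝕂 V : Type*} [Field 𝕂] [AddCommGroup V] [Module 𝕂 V]
    (A A' : Module.End 𝕂 V) : Prop where
  diagonalizable : ⨆ θ : 𝕂, Module.End.eigenspace A θ = ⊤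
  diagonalizable' : ⨆ θ : 𝕂, Module.End.eigenspace A' θ = ⊤
  exists_standard : ∃ (d : ℕ) (W : Fin (d + 1) → Submodule 𝕂 V), IsStandardOrdering A A' W
  exists_standard' : ∃ (δ : ℕ) (W : Fin (δ + 1) → Submodule 𝕂 V), IsStandardOrdering A' A W
  irreducible : ∀ W : Submodule 𝕂 V, W.map A ≤ W → W.map A' ≤ W → W = ⊥ ∨ W = ⊤

/-- `E 0, …, E d` is a standard ordering of the primitive idempotents of `A`: the subspaces
`E i V` form a standard ordering of the eigenspaces of `A`, and `E i` is the projection that is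
the identity on `E i V` and zero on `E j V` for `j ≠ i`. -/
def IsStandardIdempotentOrdering {𝕂 V : Type*} [Field 𝕂] [AddCommGroup V] [Module 𝕂 V] {d : ℕ}
    (A A' : Module.End 𝕂 V) (E : Fin (d + 1) → Module.End 𝕂 V) : Prop :=
  IsStandardOrdering A A' (fun i => LinearMap.range (E i)) ∧
    (∀ i, E i * E i = E i) ∧ ∀ i j, i ≠ j → E i * E j = 0

/-- Tridiagonal systems `(A; {E_i}; A*; {E*_i})` of diameter `d` on `V`. -/
structure TDSystem (𝕂 V : Type*) [Field 𝕂] [AddCommGroup V] [Module 𝕂 V] (d : ℕ) where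
  A : Module.End 𝕂 V
  E : Fin (d + 1) → Module.End 𝕂 V
  Astar : Module.End 𝕂 V
  Estar : Fin (d + 1) → Module.End 𝕂 V
  isTridiagonalPair : IsTridiagonalPair A Astar
  standard : IsStandardIdempotentOrdering A Astar E
  standardStar : IsStandardIdempotentOrdering Astar A Estar

namespace TDSystem

/-- The `i`-th eigenvalue (the one belonging to `E i`, respectively `E*_i`) is
`a q^{d-2i} + a⁻¹ q^{2i-d}`, respectively `b q^{d-2i} + b⁻¹ q^{2i-d}`. -/
structure IsQRacah {𝕂 V : Type*} [Field 𝕂] [AddCommGroup V] [Module 𝕂 V] {d : ℕ}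
    (Φ : TDSystem 𝕂 V d) (q a b : 𝕂) : Prop where
  q_ne_zero : q ≠ 0
  a_ne_zero : a ≠ 0
  b_ne_zero : b ≠ 0
  q_pow_four_ne_one : q ^ 4 ≠ 1
  eigenvalue : ∀ i : Fin (d + 1), LinearMap.range (Φ.E i) =
    Module.End.eigenspace Φ.A
      (a * q ^ ((d : ℤ) - 2 * (i : ℤ)) + a⁻¹ * q ^ (2 * (i : ℤ) - (d : ℤ)))
  eigenvalueStar : ∀ i : Fin (d + 1), LinearMap.range (Φ.Estar i) =
    Module.End.eigenspace Φ.Astar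
      (b * q ^ ((d : ℤ) - 2 * (i : ℤ)) + b⁻¹ * q ^ (2 * (i : ℤ) - (d : ℤ)))

/-- First split decomposition:
`U_i = (E*_0 V + ⋯ + E*_i V) ∩ (E_i V + E_{i+1} V + ⋯ + E_d V)`. -/
def U {𝕂 V : Type*} [Field 𝕂] [AddCommGroup V] [Module 𝕂 V] {d : ℕ}
    (Φ : TDSystem 𝕂 V d) (i : Fin (d + 1)) : Submodule 𝕂 V :=
  (⨆ j : Fin (d + 1), ⨆ _ : j ≤ i, LinearMap.range (Φ.Estar j)) ⊓
    (⨆ j : Fin (d + 1), ⨆ _ : i ≤ j, LinearMap.range (Φ.E j))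

/-- Second split decomposition:
`U_i^⇓ = (E*_0 V + ⋯ + E*_i V) ∩ (E_0 V + E_1 V + ⋯ + E_{d-i} V)`. -/
def Udd {𝕂 V : Type*} [Field 𝕂] [AddCommGroup V] [Module 𝕂 V] {d : ℕ}
    (Φ : TDSystem 𝕂 V d) (i : Fin (d + 1)) : Submodule 𝕂 V :=
  (⨆ j : Fin (d + 1), ⨆ _ : j ≤ i, LinearMap.range (Φ.Estar j)) ⊓
    (⨆ j : Fin (d + 1), ⨆ _ : (j : ℕ) + i ≤ d, LinearMap.range (Φ.E j))

/-- `K_i = (E*_0 V + ⋯ + E*_i V) ∩ (E_i V + E_{i+1} V + ⋯ + E_{d-i} V)`, used for `2 i ≤ d`. -/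
def KSpace {𝕂 V : Type*} [Field 𝕂] [AddCommGroup V] [Module 𝕂 V] {d : ℕ}
    (Φ : TDSystem 𝕂 V d) (i : Fin (d + 1)) : Submodule 𝕂 V :=
  (⨆ j : Fin (d + 1), ⨆ _ : j ≤ i, LinearMap.range (Φ.Estar j)) ⊓
    (⨆ j : Fin (d + 1), ⨆ _ : i ≤ j ∧ (j : ℕ) + i ≤ d, LinearMap.range (Φ.E j))

/-- The defining property of `K`: it acts on `U_i` as `q^{d-2i}`, for `0 ≤ i ≤ d`. -/
def IsK {𝕂 V : Type*} [Field 𝕂] [AddCommGroup V] [Module 𝕂 V] {d : ℕ}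
    (Φ : TDSystem 𝕂 V d) (q : 𝕂) (X : Module.End 𝕂 V) : Prop :=
  ∀ i : Fin (d + 1), ∀ v ∈ Φ.U i, X v = q ^ ((d : ℤ) - 2 * (i : ℤ)) • v

/-- The defining property of `B`: it acts on `U_i^⇓` as `q^{d-2i}`, for `0 ≤ i ≤ d`. -/
def IsB {𝕂 V : Type*} [Field 𝕂] [AddCommGroup V] [Module 𝕂 V] {d : ℕ}
    (Φ : TDSystem 𝕂 V d) (q : 𝕂) (X : Module.End 𝕂 V) : Prop :=
  ∀ i : Fin (d + 1), ∀ v ∈ Φ.Udd i, X v = q ^ ((d : ℤ) - 2 * (i : ℤ)) • v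

/-- The raising map `R = A - a K - a⁻¹ K⁻¹`. -/
def raising {𝕂 V : Type*} [Field 𝕂] [AddCommGroup V] [Module 𝕂 V] {d : ℕ}
    (Φ : TDSystem 𝕂 V d) (a : 𝕂) (K : (Module.End 𝕂 V)ˣ) : Module.End 𝕂 V :=
  Φ.A - a • (K : Module.End 𝕂 V) - a⁻¹ • ((K⁻¹ : (Module.End 𝕂 V)ˣ) : Module.End 𝕂 V)

/-- The defining property of the double lowering operator `ψ`:
`ψ R - R ψ = (q - q⁻¹)(K - K⁻¹)`, and `ψ K_i = 0` for `0 ≤ i ≤ d/2`. -/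
def IsDoubleLowering {𝕂 V : Type*} [Field 𝕂] [AddCommGroup V] [Module 𝕂 V] {d : ℕ}
    (Φ : TDSystem 𝕂 V d) (q a : 𝕂) (K : (Module.End 𝕂 V)ˣ) (X : Module.End 𝕂 V) : Prop :=
  X * Φ.raising a K - Φ.raising a K * X =
      (q - q⁻¹) • ((K : Module.End 𝕂 V) - ((K⁻¹ : (Module.End 𝕂 V)ˣ) : Module.End 𝕂 V)) ∧
    ∀ i : Fin (d + 1), 2 * (i : ℕ) ≤ d → ∀ v ∈ Φ.KSpace i, X v = 0

end TDSystem

/-!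
Write `Φ^⇓` for the tridiagonal system obtained from `Φ` by reversing the order of the `E_i`; this
replaces `a` by `a⁻¹`, the spaces `U_i` by `U_i^⇓` and `K` by `B`, and leaves the spaces `K_i`
unchanged. Every fact about `Φ` below is proved for abstract data `IsTridiagonalData`, so that it
also applies to `Φ^⇓`.

* Irreducibility gives `V = U_0 ⊕ ⋯ ⊕ U_d`: both the sum of the `U_i` and the sum of the spaces that
  obstruct directness are invariant under `A` and `A*` (`iSup_eq_bot_or_top`). This yields `K`, and
  `B` by reversal.
* The raising map `R = A - a K - a⁻¹ K⁻¹` sends `U_i` to `U_{i+1}`, and `R^{d-2i} : U_i → U_{d-i}` is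
  bijective, by the directness of the split decompositions of `Φ` and `Φ^⇓`
  (`eq_zero_of_pow_raising`, `exists_pow_raising_eq`). As in the representation theory of `sl₂`, `V`
  is the direct sum of the spaces `R^k K_j` with `2j + k ≤ d`, where `K_j` is the kernel of
  `R^{d-2j+1}` on `U_j`.
* Hence `ψ` is determined by its defining relation, and it exists: it is given by
  `ψ R^k v = (q^k - q^{-k})(q^{d-2j-k+1} - q^{-(d-2j-k+1)}) R^{k-1} v` for `v ∈ K_j`. It is nilpotent
  and satisfies `K ψ = q² ψ K` (`exists_doubleLowering`).
* Let `C = (1 - a⁻¹ q ψ)⁻¹ (1 - a q ψ) K`. The relations between `K`, `R` and `ψ` imply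
  `q C A - q⁻¹ A C = (q - q⁻¹)(a⁻¹ C² + a)` (`cleared_relation`). By this relation `C`, like `B`, acts
  as a scalar on each vector obtained from a vector of `K_j` by repeatedly applying the raising map
  of `Φ^⇓`, and the scalars agree. Such vectors span `V`, so `B = C` (`mul_eq_mul`).

The asserted equalities all follow from `B = C` and `K ψ = q² ψ K`.
-/

/-! ### Algebra of the operators -/

section Algebra

variable {𝕂 M : Type*} [Field 𝕂] [Ring M] [Algebra 𝕂 M]

/-- The relation `q C A - q⁻¹ A C = (q - q⁻¹)(a⁻¹ C² + a)` for `C = (1 - a⁻¹ q ψ)⁻¹ (1 - a q ψ) K`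
and `A = a K + a⁻¹ K⁻¹ + R`, cleared of inverses: it is multiplied by `1 - a⁻¹ q ψ` on the left and
by `1 - a⁻¹ q⁻¹ ψ` on the right, where `C (1 - a⁻¹ q⁻¹ ψ) = (1 - a q ψ) K`. -/
theorem cleared_relation {q a : 𝕂} (hq : q ≠ 0) (ha : a ≠ 0) {A K L R ψ : M}
    (hKL : K * L = 1) (hLK : L * K = 1) (hA : A = a • K + a⁻¹ • L + R)
    (hKR : R * K = q ^ 2 • (K * R)) (hKψ : K * ψ = q ^ 2 • (ψ * K))
    (hψR : ψ * R - R * ψ = (q - q⁻¹) • (K - L)) :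
    q • ((1 - (a * q) • ψ) * K * A * (1 - (a⁻¹ * q⁻¹) • ψ)) -
        q⁻¹ • ((1 - (a⁻¹ * q) • ψ) * A * ((1 - (a * q) • ψ) * K)) =
      (q - q⁻¹) • (a⁻¹ • ((1 - (a * q) • ψ) * K * ((1 - (a * q) • ψ) * K)) +
        a • ((1 - (a⁻¹ * q) • ψ) * (1 - (a⁻¹ * q⁻¹) • ψ))) := by
  have hq2 : q ^ 2 ≠ 0 := pow_ne_zero _ hq
  have hLψ : L * ψ = (q ^ 2)⁻¹ • (ψ * L) := by
    have h : ψ * L = L * (K * ψ) * L := by rw [← mul_assoc L, hLK, one_mul]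
    rw [h, hKψ, mul_smul_comm, smul_mul_assoc, inv_smul_smul₀ hq2]
    rw [mul_assoc, mul_assoc, hKL, mul_one]
  have hRψ : R * ψ = ψ * R - (q - q⁻¹) • (K - L) := by rw [← hψR]; abel
  have e1 : ∀ x, K * (ψ * x) = q ^ 2 • (ψ * (K * x)) := fun x => by
    rw [← mul_assoc, hKψ, smul_mul_assoc, mul_assoc]
  have e2 : ∀ x, L * (ψ * x) = (q ^ 2)⁻¹ • (ψ * (L * x)) := fun x => by
    rw [← mul_assoc, hLψ, smul_mul_assoc, mul_assoc]
  have e3 : ∀ x, R * (ψ * x) = ψ * (R * x) - (q - q⁻¹) • (K * x - L * x) := fun x => by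
    rw [← mul_assoc, hRψ, sub_mul, smul_mul_assoc, mul_assoc, sub_mul]
  subst hA
  simp only [mul_add, add_mul, mul_sub, sub_mul, smul_mul_assoc, mul_smul_comm, mul_assoc,
    one_mul, mul_one, hKψ, hRψ, hKR, hKL, hLK, e1, e2, e3, smul_add, smul_sub]
  match_scalars <;> field_simp <;> ring

end Algebra

/-! ### Linear maps prescribed on an independent family -/

section Prescribe

variable {𝕂 V : Type*} [Field 𝕂] [AddCommGroup V] [Module 𝕂 V]

theorem exists_end_of_independent {ι : Type*} [Fintype ι] [DecidableEq ι]
    (N : ι → Submodule 𝕂 V) (f g : ι → Module.End 𝕂 V)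
    (h : ∀ v : ι → V, (∀ p, v p ∈ N p) → ∑ p, f p (v p) = 0 → ∀ p, v p = 0) :
    ∃ X : Module.End 𝕂 V, ∀ p, ∀ v ∈ N p, X (f p v) = g p v := by
  let sum (k : ι → Module.End 𝕂 V) : (∀ p, N p) →ₗ[𝕂] V :=
    ∑ p, (k p ∘ₗ (N p).subtype) ∘ₗ LinearMap.proj p
  have sum_apply : ∀ k w, sum k w = ∑ p, k p (w p) := fun k w => by
    simp [sum, LinearMap.sum_apply]
  have sum_single : ∀ k p (v : N p), sum k (Pi.single p v) = k p v := fun k p v => by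
    rw [sum_apply, Finset.sum_eq_single p]
    · simp
    · intro r _ hr
      simp [Pi.single_eq_of_ne hr]
    · simp
  have hker : LinearMap.ker (sum f) = ⊥ := by
    rw [LinearMap.ker_eq_bot']
    intro w hw
    rw [sum_apply] at hw
    funext p
    exact Subtype.ext (h (fun p => w p) (fun p => (w p).2) hw p)
  obtain ⟨T, hT⟩ := (sum f).exists_leftInverse_of_injective hker
  refine ⟨sum g ∘ₗ T, fun p v hv => ?_⟩
  have h1 := LinearMap.congr_fun hT (Pi.single p ⟨v, hv⟩)
  rw [LinearMap.comp_apply, sum_single] at h1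
  simp only [LinearMap.id_apply] at h1
  rw [LinearMap.comp_apply, h1, sum_single]

end Prescribe

/-! ### Tridiagonal resolutions of the identity -/

section Resolution

variable {𝕂 V : Type*} [Field 𝕂] [AddCommGroup V] [Module 𝕂 V] {d : ℕ}

/-- `E 0, …, E d` are nonzero orthogonal idempotents that sum to `1`, on which `A` has the
eigenvalues `θ 0, …, θ d`, and `A'` is block tridiagonal with respect to them. The sequence `θ`
is indexed by `ℕ`; its values beyond `d` are irrelevant. -/
structure IsTridiagonalResolution (A A' : Module.End 𝕂 V) (E : Fin (d + 1) → Module.End 𝕂 V)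
    (θ : ℕ → 𝕂) : Prop where
  sum_eq_one : ∑ j, E j = 1
  idem : ∀ j, E j * E j = E j
  orth : ∀ i j, i ≠ j → E i * E j = 0
  mul_left : ∀ j : Fin (d + 1), E j * A = θ j • E j
  tridiag : ∀ i j : Fin (d + 1), ¬ ((j : ℕ) ≤ i + 1 ∧ (i : ℕ) ≤ j + 1) → E j * A' * E i = 0
  ne_zero : ∀ j, E j ≠ 0

/-- The sum of the subspaces `E j V` over the indices `j` with `p j`. -/
def specSum (E : Fin (d + 1) → Module.End 𝕂 V) (p : ℕ → Prop) : Submodule 𝕂 V :=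
  ⨆ j : Fin (d + 1), ⨆ _ : p j, LinearMap.range (E j)

namespace IsTridiagonalResolution

variable {A A' : Module.End 𝕂 V} {E : Fin (d + 1) → Module.End 𝕂 V} {θ : ℕ → 𝕂}

theorem sum_apply (h : IsTridiagonalResolution A A' E θ) (v : V) : ∑ j, E j v = v := by
  rw [← LinearMap.sum_apply, h.sum_eq_one, Module.End.one_apply]

theorem ext (h : IsTridiagonalResolution A A' E θ) {v w : V} (hvw : ∀ j, E j v = E j w) :
    v = w := by
  rw [← h.sum_apply v, ← h.sum_apply w]
  exact Finset.sum_congr rfl fun j _ => hvw j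

theorem apply_apply (h : IsTridiagonalResolution A A' E θ) (i j : Fin (d + 1)) (v : V) :
    E i (E j v) = if i = j then E i v else 0 := by
  split_ifs with hij
  · subst hij
    rw [← Module.End.mul_apply, h.idem]
  · rw [← Module.End.mul_apply, h.orth i j hij, LinearMap.zero_apply]

theorem apply_map (h : IsTridiagonalResolution A A' E θ) (j : Fin (d + 1)) (v : V) :
    E j (A v) = θ j • E j v := by
  rw [← Module.End.mul_apply, h.mul_left, LinearMap.smul_apply]

theorem mem_specSum (h : IsTridiagonalResolution A A' E θ) {p : ℕ → Prop} {v : V} :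
    v ∈ specSum E p ↔ ∀ j : Fin (d + 1), ¬ p j → E j v = 0 := by
  constructor
  · intro hv j hj
    have : specSum E p ≤ LinearMap.ker (E j) := by
      refine iSup_le fun k => iSup_le fun hk => ?_
      rintro _ ⟨w, rfl⟩
      rw [LinearMap.mem_ker, h.apply_apply, if_neg]
      rintro rfl
      exact hj hk
    exact this hv
  · intro hv
    rw [← h.sum_apply v]
    refine Submodule.sum_mem _ fun j _ => ?_
    by_cases hj : p j
    · exact Submodule.mem_iSup_of_mem j (Submodule.mem_iSup_of_mem hj ⟨v, rfl⟩)
    · rw [hv j hj]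
      exact Submodule.zero_mem _

theorem specSum_mono (h : IsTridiagonalResolution A A' E θ) {p r : ℕ → Prop}
    (hpr : ∀ j, j ≤ d → p j → r j) : specSum E p ≤ specSum E r := fun v hv => by
  rw [h.mem_specSum] at hv ⊢
  exact fun j hj => hv j fun hp => hj (hpr j (Nat.lt_succ_iff.mp j.2) hp)

theorem sub_smul_mem (h : IsTridiagonalResolution A A' E θ) {p r : ℕ → Prop} (n : ℕ)
    (hpr : ∀ j, j ≤ d → p j → ¬ r j → j = n) {v : V} (hv : v ∈ specSum E p) :
    A v - θ n • v ∈ specSum E r := by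
  rw [h.mem_specSum] at hv ⊢
  intro j hj
  rw [map_sub, map_smul, h.apply_map]
  by_cases hp : p j
  · rw [hpr j (Nat.lt_succ_iff.mp j.2) hp hj, sub_self]
  · rw [hv j hp, smul_zero, smul_zero, sub_zero]

theorem map_mem (h : IsTridiagonalResolution A A' E θ) {p r : ℕ → Prop}
    (hpr : ∀ i j, j ≤ d → p i → j ≤ i + 1 → i ≤ j + 1 → r j) {v : V} (hv : v ∈ specSum E p) :
    A' v ∈ specSum E r := by
  rw [h.mem_specSum] at hv ⊢
  intro j hj
  conv_lhs => rw [← h.sum_apply v, map_sum, map_sum]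
  refine Finset.sum_eq_zero fun i _ => ?_
  by_cases hp : p i
  · have : E j * A' * E i = 0 :=
      h.tridiag i j fun hij => hj (hpr i j (Nat.lt_succ_iff.mp j.2) hp hij.1 hij.2)
    exact LinearMap.congr_fun this v
  · rw [hv i hp, map_zero, map_zero]

/-- For a block tridiagonal `A'`, subtracting a scalar does not affect which components can
become nonzero. -/
theorem map_sub_smul_mem (h : IsTridiagonalResolution A A' E θ) {p r : ℕ → Prop}
    (hpr : ∀ i j, j ≤ d → p i → j ≤ i + 1 → i ≤ j + 1 → r j) (c : 𝕂) {v : V}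
    (hv : v ∈ specSum E p) : A' v - c • v ∈ specSum E r :=
  Submodule.sub_mem _ (h.map_mem hpr hv) (Submodule.smul_mem _ _
    (h.specSum_mono (fun j hj hp => hpr j j hj hp (by omega) (by omega)) hv))

theorem specSum_ne_bot (h : IsTridiagonalResolution A A' E θ) {p : ℕ → Prop}
    (j : Fin (d + 1)) (hj : p j) : specSum E p ≠ ⊥ := fun hb => by
  refine h.ne_zero j (LinearMap.ext fun v => ?_)
  have : E j v ∈ specSum E p :=
    Submodule.mem_iSup_of_mem j (Submodule.mem_iSup_of_mem hj ⟨v, rfl⟩)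
  rw [hb] at this
  exact this

theorem specSum_ne_top (h : IsTridiagonalResolution A A' E θ) {p : ℕ → Prop}
    (j : Fin (d + 1)) (hj : ¬ p j) : specSum E p ≠ ⊤ := fun ht => by
  refine h.ne_zero j (LinearMap.ext fun v => ?_)
  exact h.mem_specSum.mp (ht ▸ Submodule.mem_top : v ∈ specSum E p) j hj

theorem rev (h : IsTridiagonalResolution A A' E θ) :
    IsTridiagonalResolution A A' (fun j => E j.rev) (fun n => θ (d - n)) where
  sum_eq_one := by rw [← h.sum_eq_one]; exact Equiv.sum_comp Fin.revPerm E
  idem j := h.idem _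
  orth i j hij := h.orth _ _ fun e => hij (Fin.rev_injective e)
  mul_left j := by
    rw [h.mul_left, Fin.val_rev]
    congr 2
    omega
  tridiag i j hij := h.tridiag _ _ (by rw [Fin.val_rev, Fin.val_rev]; omega)
  ne_zero j := h.ne_zero _

theorem specSum_rev (h : IsTridiagonalResolution A A' E θ) (p : ℕ → Prop) :
    specSum (fun j => E j.rev) p = specSum E (fun j => p (d - j)) := by
  ext v
  rw [h.mem_specSum, h.rev.mem_specSum]
  have key : ∀ j : Fin (d + 1), d - (j.rev : ℕ) = j := fun j => by rw [Fin.val_rev]; omega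
  have key' : ∀ j : Fin (d + 1), d - (j : ℕ) = j.rev := fun j => by rw [Fin.val_rev]; omega
  constructor
  · intro hv j hj
    have := hv j.rev (by rwa [← key'])
    rwa [Fin.rev_rev] at this
  · intro hv j hj
    exact hv j.rev (by rwa [key])

end IsTridiagonalResolution

end Resolution

/-! ### The split decomposition -/

section Split

variable {𝕂 V : Type*} [Field 𝕂] [AddCommGroup V] [Module 𝕂 V] {d : ℕ}

theorem map_mem_iSup {P : ℕ → Submodule 𝕂 V} {X : Module.End 𝕂 V}
    (hX : ∀ n, ∃ c : 𝕂, ∀ v ∈ P n, X v - c • v ∈ ⨆ n, P n) : ∀ v ∈ ⨆ n, P n, X v ∈ ⨆ n, P n := by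
  suffices hle : ⨆ n, P n ≤ (⨆ n, P n).comap X from fun v hv => hle hv
  refine iSup_le fun n v hv => ?_
  obtain ⟨c, hc⟩ := hX n
  have := Submodule.add_mem _ (hc v hv) (Submodule.smul_mem _ c (Submodule.mem_iSup_of_mem n hv))
  rwa [sub_add_cancel] at this

/-- Two operators that are block tridiagonal with respect to each other's eigenspaces, and that
have no common invariant subspace: a tridiagonal system, described through its idempotents. -/
structure IsTridiagonalData (A : Module.End 𝕂 V) (E : Fin (d + 1) → Module.End 𝕂 V) (θ : ℕ → 𝕂)
    (As : Module.End 𝕂 V) (Es : Fin (d + 1) → Module.End 𝕂 V) (θs : ℕ → 𝕂) : Prop where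
  res : IsTridiagonalResolution A As E θ
  resStar : IsTridiagonalResolution As A Es θs
  inj : ∀ i j, i ≤ d → j ≤ d → θ i = θ j → i = j
  irreducible : ∀ W : Submodule 𝕂 V, (∀ v ∈ W, A v ∈ W) → (∀ v ∈ W, As v ∈ W) → W = ⊥ ∨ W = ⊤

/-- `(E*_0 V + ⋯ + E*_i V) ∩ (E_i V + ⋯ + E_d V)`; this is `0` for `i > d`. -/
def splitSpace (E Es : Fin (d + 1) → Module.End 𝕂 V) (i : ℕ) : Submodule 𝕂 V :=
  specSum Es (· ≤ i) ⊓ specSum E (i ≤ ·)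

/-- `(E*_0 V + ⋯ + E*_i V) ∩ (E_i V + ⋯ + E_{d-i} V)`. -/
def kerSpace (E Es : Fin (d + 1) → Module.End 𝕂 V) (i : ℕ) : Submodule 𝕂 V :=
  specSum Es (· ≤ i) ⊓ specSum E (fun j => i ≤ j ∧ j + i ≤ d)

namespace IsTridiagonalData

variable {A As : Module.End 𝕂 V} {E Es : Fin (d + 1) → Module.End 𝕂 V} {θ θs : ℕ → 𝕂}

theorem rev (h : IsTridiagonalData A E θ As Es θs) :
    IsTridiagonalData A (fun j => E j.rev) (fun n => θ (d - n)) As Es θs where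
  res := h.res.rev
  resStar := h.resStar
  inj i j hi hj hij := by
    have := h.inj _ _ (Nat.sub_le d i) (Nat.sub_le d j) hij
    omega
  irreducible := h.irreducible

theorem kerSpace_rev (h : IsTridiagonalData A E θ As Es θs) (i : ℕ) :
    kerSpace (fun j => E j.rev) Es i = kerSpace E Es i := by
  rw [kerSpace, kerSpace, h.res.specSum_rev]
  congr 1
  exact le_antisymm (h.res.specSum_mono fun j _ _ => by omega)
    (h.res.specSum_mono fun j _ _ => by omega)

/-- The spaces `(E*_0 V + ⋯ + E*_{n-1} V) ∩ (E_{n-k} V + ⋯ + E_d V)` together span a common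
invariant subspace. For `k = 1` they are the components of the split decomposition; for `k = 0`
they measure the failure of that decomposition to be direct. -/
theorem iSup_eq_bot_or_top (h : IsTridiagonalData A E θ As Es θs) (k : ℕ) :
    (⨆ n : ℕ, specSum Es (· < n) ⊓ specSum E (n ≤ · + k)) = ⊥ ∨
      (⨆ n : ℕ, specSum Es (· < n) ⊓ specSum E (n ≤ · + k)) = ⊤ := by
  refine h.irreducible _ (map_mem_iSup fun n => ⟨θ (n - k), fun v hv => ?_⟩) (map_mem_iSup fun n => ?_)
  · refine Submodule.mem_iSup_of_mem (n + 1) ⟨?_, ?_⟩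
    · exact h.resStar.map_sub_smul_mem (fun i j _ _ _ _ => by omega) _ hv.1
    · exact h.res.sub_smul_mem _ (fun j _ _ _ => by omega) hv.2
  · obtain _ | n := n
    · refine ⟨0, fun v hv => ?_⟩
      have : v = 0 := h.resStar.ext fun j => by
        rw [h.resStar.mem_specSum.mp hv.1 j (by omega), map_zero]
      rw [this, map_zero, smul_zero, sub_zero]
      exact Submodule.zero_mem _
    · refine ⟨θs n, fun v hv => Submodule.mem_iSup_of_mem n ⟨?_, ?_⟩⟩
      · exact h.resStar.sub_smul_mem _ (fun j _ _ _ => by omega) hv.1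
      · exact h.res.map_sub_smul_mem (fun i j _ _ _ _ => by omega) _ hv.2

/-- The directness of the split decomposition: the obstruction is an invariant subspace inside
`E_1 V + ⋯ + E_d V`, hence zero. -/
theorem eq_zero_of_mem (h : IsTridiagonalData A E θ As Es θs) {n : ℕ} {v : V}
    (hs : v ∈ specSum Es (· < n)) (hv : v ∈ specSum E (n ≤ ·)) : v = 0 := by
  obtain hb | ht := h.iSup_eq_bot_or_top 0
  · have : v ∈ ⨆ n : ℕ, specSum Es (· < n) ⊓ specSum E (n ≤ · + 0) :=
      Submodule.mem_iSup_of_mem n ⟨hs, hv⟩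
    rwa [hb] at this
  · refine absurd (top_le_iff.mp (ht ▸ iSup_le fun n w hw => ?_))
      (h.res.specSum_ne_top (p := (1 ≤ ·)) 0 (by simp))
    rw [h.res.mem_specSum]
    intro j hj
    -- Only the piece `n = 0` could meet `E_0 V`, and that piece is zero.
    obtain rfl | hn := Nat.eq_zero_or_pos n
    · have : w = 0 := h.resStar.ext fun j => by
        rw [h.resStar.mem_specSum.mp hw.1 j (by omega), map_zero]
      rw [this, map_zero]
    · exact h.res.mem_specSum.mp hw.2 j (by omega)

/-- `eq_zero_of_mem` for the system with the `E_j` in reversed order. -/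
theorem eq_zero_of_mem' (h : IsTridiagonalData A E θ As Es θs) {n : ℕ} {v : V}
    (hs : v ∈ specSum Es (· < n)) (hv : v ∈ specSum E (fun j => j + n ≤ d)) : v = 0 := by
  refine h.rev.eq_zero_of_mem hs ?_
  rw [h.res.specSum_rev]
  exact h.res.specSum_mono (fun j _ _ => by omega) hv

theorem iSup_splitSpace (h : IsTridiagonalData A E θ As Es θs) :
    ⨆ i, splitSpace E Es i = ⊤ := by
  have hle : (⨆ n : ℕ, specSum Es (· < n) ⊓ specSum E (n ≤ · + 1)) ≤ ⨆ i, splitSpace E Es i := by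
    refine iSup_le fun n v hv => ?_
    obtain _ | n := n
    · have : v = 0 := h.resStar.ext fun j => by
        rw [h.resStar.mem_specSum.mp hv.1 j (by omega), map_zero]
      rw [this]
      exact Submodule.zero_mem _
    · exact Submodule.mem_iSup_of_mem n ⟨h.resStar.specSum_mono (fun j _ _ => by omega) hv.1,
        h.res.specSum_mono (fun j _ _ => by omega) hv.2⟩
  obtain hb | ht := h.iSup_eq_bot_or_top 1
  · refine absurd (le_bot_iff.mp (hb ▸ fun v hv => ?_))
      (h.resStar.specSum_ne_bot (p := (· < 1)) 0 (by simp))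
    exact Submodule.mem_iSup_of_mem 1 ⟨hv, h.res.mem_specSum.mpr fun j hj => by omega⟩
  · rwa [ht, top_le_iff] at hle

theorem splitSpace_eq_bot (h : IsTridiagonalData A E θ As Es θs) {i : ℕ} (hi : d < i) :
    splitSpace E Es i = ⊥ := by
  rw [eq_bot_iff]
  intro v hv
  exact h.res.ext fun j => by rw [h.res.mem_specSum.mp hv.2 j (by omega), map_zero]

theorem eq_top_of_splitSpace_le (h : IsTridiagonalData A E θ As Es θs) {W : Submodule 𝕂 V}
    (hW : ∀ i ≤ d, splitSpace E Es i ≤ W) : W = ⊤ := by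
  rw [← top_le_iff, ← h.iSup_splitSpace]
  refine iSup_le fun i => ?_
  obtain hi | hi := le_or_gt i d
  · exact hW i hi
  · rw [h.splitSpace_eq_bot hi]
    exact bot_le

theorem splitSpace_independent (h : IsTridiagonalData A E θ As Es θs) (v : Fin (d + 1) → V)
    (hv : ∀ i : Fin (d + 1), v i ∈ splitSpace E Es i) (hsum : ∑ i, v i = 0) (i : Fin (d + 1)) : v i = 0 := by
  induction i using WellFoundedLT.induction with
  | ind i ih =>
    refine h.eq_zero_of_mem (n := i + 1)
      (h.resStar.specSum_mono (fun j _ _ => by omega) (hv i).1) ?_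
    have hi : v i = -∑ j ∈ Finset.univ.erase i, v j := by
      rw [eq_neg_iff_add_eq_zero, Finset.add_sum_erase _ _ (Finset.mem_univ i), hsum]
    rw [hi]
    refine Submodule.neg_mem _ (Submodule.sum_mem _ fun j hj => ?_)
    obtain hlt | hlt := lt_or_gt_of_ne (Finset.ne_of_mem_erase hj)
    · rw [ih j hlt]
      exact Submodule.zero_mem _
    · have : (i : ℕ) < j := hlt
      exact h.res.specSum_mono (fun k _ _ => by omega) (hv j).2

theorem exists_diag (h : IsTridiagonalData A E θ As Es θs) (c : ℕ → 𝕂) :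
    ∃ X : Module.End 𝕂 V, ∀ i, ∀ v ∈ splitSpace E Es i, X v = c i • v := by
  obtain ⟨X, hX⟩ := exists_end_of_independent (fun i : Fin (d + 1) => splitSpace E Es i)
    (fun _ => 1) (fun i => c i • 1) (by simpa using h.splitSpace_independent)
  refine ⟨X, fun i v hv => ?_⟩
  obtain hi | hi := le_or_gt i d
  · simpa using hX ⟨i, by omega⟩ v hv
  · rw [h.splitSpace_eq_bot hi, Submodule.mem_bot] at hv
    rw [hv, map_zero, smul_zero]

theorem ext_splitSpace (h : IsTridiagonalData A E θ As Es θs) {X Y : Module.End 𝕂 V}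
    (hXY : ∀ i ≤ d, ∀ v ∈ splitSpace E Es i, X v = Y v) : X = Y :=
  LinearMap.eqLocus_eq_top.mp (h.eq_top_of_splitSpace_le hXY)

end IsTridiagonalData

end Split

/-! ### The raising map -/

section Raising

variable {𝕂 V : Type*} [Field 𝕂] [AddCommGroup V] [Module 𝕂 V] {d : ℕ}

/-- The product `(A - θ (i + n - 1)) ⋯ (A - θ (i + 1)) (A - θ i)`. -/
def shiftedProd (A : Module.End 𝕂 V) (θ : ℕ → 𝕂) (i : ℕ) : ℕ → Module.End 𝕂 V
  | 0 => 1
  | n + 1 => (A - θ (i + n) • 1) * shiftedProd A θ i n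

namespace IsTridiagonalData

variable {A As : Module.End 𝕂 V} {E Es : Fin (d + 1) → Module.End 𝕂 V} {θ θs : ℕ → 𝕂}
  {R : Module.End 𝕂 V}

theorem shiftedProd_succ_apply (i n : ℕ) (v : V) :
    shiftedProd A θ i (n + 1) v =
      A (shiftedProd A θ i n v) - θ (i + n) • shiftedProd A θ i n v := by
  simp [shiftedProd]

theorem apply_shiftedProd (h : IsTridiagonalData A E θ As Es θs) (i n : ℕ) (j : Fin (d + 1))
    (v : V) :
    E j (shiftedProd A θ i n v) = (∏ m ∈ Finset.range n, (θ j - θ (i + m))) • E j v := by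
  induction n with
  | zero => simp [shiftedProd]
  | succ n ih =>
    rw [shiftedProd_succ_apply, map_sub, map_smul, h.res.apply_map, ih, Finset.prod_range_succ,
      ← sub_smul, smul_smul, mul_comm]

theorem shiftedProd_mem (h : IsTridiagonalData A E θ As Es θs) (i n : ℕ) {v : V}
    (hv : v ∈ specSum Es (· ≤ i)) : shiftedProd A θ i n v ∈ specSum Es (· ≤ i + n) := by
  induction n with
  | zero => exact hv
  | succ n ih =>
    rw [shiftedProd_succ_apply]
    exact h.resStar.map_sub_smul_mem (fun _ _ _ _ _ _ => by omega) _ ih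

theorem prod_eq_zero (i n j : ℕ) (hij : i ≤ j) (hj : j < i + n) :
    ∏ m ∈ Finset.range n, (θ j - θ (i + m)) = 0 :=
  Finset.prod_eq_zero (i := j - i) (Finset.mem_range.mpr (by omega))
    (by rw [Nat.add_sub_cancel' hij, sub_self])

theorem prod_ne_zero (h : IsTridiagonalData A E θ As Es θs) {i n j : ℕ} (hj : j ≤ d)
    (hn : i + n ≤ d + 1) (hij : j < i ∨ i + n ≤ j) :
    ∏ m ∈ Finset.range n, (θ j - θ (i + m)) ≠ 0 := by
  refine Finset.prod_ne_zero_iff.mpr fun m hm => sub_ne_zero.mpr fun e => ?_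
  rw [Finset.mem_range] at hm
  have := h.inj _ _ hj (by omega) e
  omega

theorem raising_mem (h : IsTridiagonalData A E θ As Es θs)
    (hR : ∀ i, ∀ v ∈ splitSpace E Es i, R v = A v - θ i • v) {i : ℕ} {v : V}
    (hv : v ∈ splitSpace E Es i) : R v ∈ splitSpace E Es (i + 1) := by
  rw [hR i v hv]
  exact ⟨h.resStar.map_sub_smul_mem (fun _ _ _ _ _ _ => by omega) _ hv.1,
    h.res.sub_smul_mem _ (fun _ _ _ _ => by omega) hv.2⟩

theorem pow_raising_mem (h : IsTridiagonalData A E θ As Es θs)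
    (hR : ∀ i, ∀ v ∈ splitSpace E Es i, R v = A v - θ i • v) {i : ℕ} {v : V}
    (hv : v ∈ splitSpace E Es i) (n : ℕ) : (R ^ n) v ∈ splitSpace E Es (i + n) := by
  induction n with
  | zero => exact hv
  | succ n ih =>
    rw [pow_succ', Module.End.mul_apply]
    exact h.raising_mem hR ih

theorem pow_raising_eq (h : IsTridiagonalData A E θ As Es θs)
    (hR : ∀ i, ∀ v ∈ splitSpace E Es i, R v = A v - θ i • v) {i : ℕ} {v : V}
    (hv : v ∈ splitSpace E Es i) (n : ℕ) : (R ^ n) v = shiftedProd A θ i n v := by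
  induction n with
  | zero => rfl
  | succ n ih =>
    rw [pow_succ', Module.End.mul_apply, hR _ _ (h.pow_raising_mem hR hv n), ih,
      shiftedProd_succ_apply]

theorem pow_raising_eq_zero_iff (h : IsTridiagonalData A E θ As Es θs)
    (hR : ∀ i, ∀ v ∈ splitSpace E Es i, R v = A v - θ i • v) {i n : ℕ} {v : V}
    (hn : i + n ≤ d + 1) (hv : v ∈ splitSpace E Es i) :
    (R ^ n) v = 0 ↔ ∀ j : Fin (d + 1), i + n ≤ j → E j v = 0 := by
  rw [h.pow_raising_eq hR hv]
  constructor
  · intro h0 j hj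
    have := h.apply_shiftedProd i n j v
    rw [h0, map_zero, eq_comm, smul_eq_zero] at this
    exact this.resolve_left (h.prod_ne_zero (by omega) hn (Or.inr hj))
  · intro h0
    refine h.res.ext fun j => ?_
    rw [h.apply_shiftedProd, map_zero]
    obtain hj | hj := le_or_gt (i + n) j
    · rw [h0 j hj, smul_zero]
    · obtain hi | hi := le_or_gt i j
      · rw [prod_eq_zero i n j hi hj, zero_smul]
      · rw [h.res.mem_specSum.mp hv.2 j (by omega), smul_zero]

/-- `K_i` is the kernel of `R^{d-2i+1}` on the `i`-th component of the split decomposition. -/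
theorem mem_kerSpace_iff (h : IsTridiagonalData A E θ As Es θs)
    (hR : ∀ i, ∀ v ∈ splitSpace E Es i, R v = A v - θ i • v) {i : ℕ} {v : V} (hi : 2 * i ≤ d) :
    v ∈ kerSpace E Es i ↔ v ∈ splitSpace E Es i ∧ (R ^ (d - 2 * i + 1)) v = 0 := by
  constructor
  · intro hv
    have hv' : v ∈ splitSpace E Es i := ⟨hv.1, h.res.specSum_mono (fun j _ hj => hj.1) hv.2⟩
    refine ⟨hv', (h.pow_raising_eq_zero_iff hR (by omega) hv').mpr fun j hj => ?_⟩
    exact h.res.mem_specSum.mp hv.2 j (by omega)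
  · rintro ⟨hv, h0⟩
    rw [h.pow_raising_eq_zero_iff hR (by omega) hv] at h0
    refine ⟨hv.1, h.res.mem_specSum.mpr fun j hj => ?_⟩
    obtain hij | hij := le_or_gt i j
    · exact h0 j (by omega)
    · exact h.res.mem_specSum.mp hv.2 j (by omega)

/-- `R^{d-2i}` is injective on the `i`-th component of the split decomposition: its kernel lies
in `(E*_0 V + ⋯ + E*_i V) ∩ (E_0 V + ⋯ + E_{d-i-1} V)`, which vanishes by the directness of the
split decomposition of the system with the `E_j` in reversed order. -/
theorem eq_zero_of_pow_raising (h : IsTridiagonalData A E θ As Es θs)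
    (hR : ∀ i, ∀ v ∈ splitSpace E Es i, R v = A v - θ i • v) {i : ℕ} {v : V} (hi : 2 * i ≤ d)
    (hv : v ∈ splitSpace E Es i) (h0 : (R ^ (d - 2 * i)) v = 0) : v = 0 := by
  rw [h.pow_raising_eq_zero_iff hR (by omega) hv] at h0
  exact h.eq_zero_of_mem' (n := i + 1) (h.resStar.specSum_mono (fun j _ _ => by omega) hv.1)
    (h.res.mem_specSum.mpr fun j hj => h0 j (by omega))

theorem sup_eq_top (h : IsTridiagonalData A E θ As Es θs) (n : ℕ) :
    specSum Es (· < n) ⊔ specSum E (n ≤ ·) = ⊤ := by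
  refine h.eq_top_of_splitSpace_le fun i _ v hv => ?_
  obtain hi | hi := lt_or_ge i n
  · exact Submodule.mem_sup_left (h.resStar.specSum_mono (fun j _ _ => by omega) hv.1)
  · exact Submodule.mem_sup_right (h.res.specSum_mono (fun j _ _ => by omega) hv.2)

/-- `R^{d-2i}` maps the `i`-th component of the split decomposition onto the `(d-i)`-th. -/
theorem exists_pow_raising_eq (h : IsTridiagonalData A E θ As Es θs)
    (hR : ∀ i, ∀ v ∈ splitSpace E Es i, R v = A v - θ i • v) {i : ℕ} {u : V} (hi : 2 * i ≤ d)
    (hu : u ∈ splitSpace E Es (d - i)) :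
    ∃ x ∈ splitSpace E Es i, (R ^ (d - 2 * i)) x = u := by
  set T := shiftedProd A θ i (d - 2 * i) with hT
  -- `T` is invertible on `E_{d-i} V + ⋯ + E_d V`; let `w` be the preimage of `u` there.
  obtain ⟨w, hw, hwu⟩ : ∃ w, (∀ j : Fin (d + 1), (j : ℕ) < d - i → E j w = 0) ∧ T w = u := by
    have hE : ∀ j : Fin (d + 1), E j (∑ k : Fin (d + 1),
        (∏ m ∈ Finset.range (d - 2 * i), (θ k - θ (i + m)))⁻¹ • E k u) =
        (∏ m ∈ Finset.range (d - 2 * i), (θ j - θ (i + m)))⁻¹ • E j u := by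
      intro j
      rw [map_sum, Finset.sum_eq_single j]
      · rw [map_smul, h.res.apply_apply, if_pos rfl]
      · intro k _ hk
        rw [map_smul, h.res.apply_apply, if_neg hk.symm, smul_zero]
      · simp
    refine ⟨∑ k : Fin (d + 1), (∏ m ∈ Finset.range (d - 2 * i), (θ k - θ (i + m)))⁻¹ • E k u,
      fun j hj => ?_, h.res.ext fun j => ?_⟩
    · rw [hE, h.res.mem_specSum.mp hu.2 j (by omega), smul_zero]
    · rw [hT, h.apply_shiftedProd, hE]
      obtain hj | hj := le_or_gt (d - i) j
      · rw [smul_inv_smul₀ (h.prod_ne_zero (by omega) (by omega) (Or.inr (by omega)))]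
      · rw [h.res.mem_specSum.mp hu.2 j (by omega), smul_zero, smul_zero]
  -- Split `w` along the complement of `E*_0 V + ⋯ + E*_i V` that `T` maps into
  -- `E_0 V + ⋯ + E_{i-1} V`.
  have htop := h.rev.sup_eq_top (i + 1)
  rw [h.res.specSum_rev] at htop
  obtain ⟨x, hx, y, hy, hxy⟩ := Submodule.mem_sup.mp (htop ▸ Submodule.mem_top : w ∈ _)
  replace hx : x ∈ specSum Es (· ≤ i) := h.resStar.specSum_mono (fun j _ _ => by omega) hx
  have hTy : T y = 0 := by
    refine h.eq_zero_of_mem' (n := d - i + 1) ?_ (h.res.mem_specSum.mpr fun j hj => ?_)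
    · have : T y = u - T x := by rw [← hwu, ← hxy, map_add, add_sub_cancel_left]
      rw [this]
      exact Submodule.sub_mem _ (h.resStar.specSum_mono (fun j _ _ => by omega) hu.1)
        (h.resStar.specSum_mono (fun j _ _ => by omega) (h.shiftedProd_mem i (d - 2 * i) hx))
    · rw [hT, h.apply_shiftedProd]
      obtain hj' | hj' := lt_or_ge (j : ℕ) (d - i)
      · rw [prod_eq_zero i _ j (by omega) (by omega), zero_smul]
      · rw [h.res.mem_specSum.mp hy j (by omega), smul_zero]
  have hxU : x ∈ splitSpace E Es i := by
    refine ⟨hx, h.res.mem_specSum.mpr fun j hj => ?_⟩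
    have hy0 : E j y = 0 := by
      have := h.apply_shiftedProd i (d - 2 * i) j y
      rw [← hT, hTy, map_zero, eq_comm, smul_eq_zero] at this
      exact this.resolve_left (h.prod_ne_zero (by omega) (by omega) (Or.inl (by omega)))
    have := hw j (by omega)
    rwa [← hxy, map_add, hy0, add_zero] at this
  refine ⟨x, hxU, ?_⟩
  rw [h.pow_raising_eq hR hxU, ← hT, ← hwu, ← hxy, map_add, hTy, add_zero]

/-- The spaces `K_i` generate `V` under the raising map. -/
theorem eq_top_of_raising_invariant (h : IsTridiagonalData A E θ As Es θs)
    (hR : ∀ i, ∀ v ∈ splitSpace E Es i, R v = A v - θ i • v) {W : Submodule 𝕂 V}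
    (hWR : ∀ v ∈ W, R v ∈ W) (hW : ∀ i, 2 * i ≤ d → kerSpace E Es i ≤ W) : W = ⊤ := by
  have hpow : ∀ n, ∀ v ∈ W, (R ^ n) v ∈ W := fun n => by
    induction n with
    | zero => exact fun v hv => hv
    | succ n ih =>
      intro v hv
      rw [pow_succ', Module.End.mul_apply]
      exact hWR _ (ih v hv)
  have hlow : ∀ i, 2 * i ≤ d → splitSpace E Es i ≤ W := fun i => by
    induction i with
    | zero =>
      exact fun _ v hv => hW 0 (by omega) ⟨hv.1, h.res.specSum_mono (fun j _ _ => by omega) hv.2⟩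
    | succ i ih =>
      intro hi u hu
      -- Subtracting an element of `R U_i` moves `u` into `K_{i+1}`.
      have hRu : (R ^ (d - 2 * (i + 1) + 1)) u ∈ splitSpace E Es (d - i) := by
        have := h.pow_raising_mem hR hu (d - 2 * (i + 1) + 1)
        rwa [show i + 1 + (d - 2 * (i + 1) + 1) = d - i by omega] at this
      obtain ⟨x, hx, hxu⟩ := h.exists_pow_raising_eq hR (by omega) hRu
      have hk : u - R x ∈ kerSpace E Es (i + 1) := by
        refine (h.mem_kerSpace_iff hR hi).mpr
          ⟨Submodule.sub_mem _ hu (h.raising_mem hR hx), ?_⟩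
        rw [map_sub, ← Module.End.mul_apply, ← pow_succ,
          show d - 2 * (i + 1) + 1 + 1 = d - 2 * i by omega, hxu, sub_self]
      have := Submodule.add_mem _ (hW _ hi hk) (hWR x (ih (by omega) hx))
      rwa [sub_add_cancel] at this
  refine h.eq_top_of_splitSpace_le fun i hid u hu => ?_
  obtain hi | hi := le_or_gt (2 * i) d
  · exact hlow i hi hu
  · rw [show i = d - (d - i) by omega] at hu
    obtain ⟨x, hx, rfl⟩ := h.exists_pow_raising_eq hR (by omega) hu
    exact hpow _ _ (hlow _ (by omega) hx)

theorem ext_pow_raising (h : IsTridiagonalData A E θ As Es θs)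
    (hR : ∀ i, ∀ v ∈ splitSpace E Es i, R v = A v - θ i • v) {X Y : Module.End 𝕂 V}
    (hXY : ∀ i, 2 * i ≤ d → ∀ v ∈ kerSpace E Es i, ∀ n, X ((R ^ n) v) = Y ((R ^ n) v)) :
    X = Y := by
  refine LinearMap.eqLocus_eq_top.mp (top_le_iff.mp ?_)
  set W : Submodule 𝕂 V := ⨆ (n : ℕ) (i : ℕ) (_ : 2 * i ≤ d), (kerSpace E Es i).map (R ^ n)
    with hWdef
  have hmem : ∀ n i, 2 * i ≤ d → ∀ v ∈ kerSpace E Es i, (R ^ n) v ∈ W := fun n i hi v hv =>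
    Submodule.mem_iSup_of_mem n (Submodule.mem_iSup_of_mem i
      (Submodule.mem_iSup_of_mem hi (Submodule.mem_map_of_mem hv)))
  have hW : W = ⊤ := by
    refine h.eq_top_of_raising_invariant hR ?_ fun i hi v hv => hmem 0 i hi v hv
    suffices hle : W ≤ W.comap R from fun v hv => hle hv
    refine iSup_le fun n => iSup_le fun i => iSup_le fun hi => ?_
    rintro _ ⟨v, hv, rfl⟩
    rw [Submodule.mem_comap, ← Module.End.mul_apply, ← pow_succ']
    exact hmem (n + 1) i hi v hv
  rw [← hW]
  refine iSup_le fun n => iSup_le fun i => iSup_le fun hi => ?_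
  rintro _ ⟨v, hv, rfl⟩
  exact hXY i hi v hv n

theorem pow_raising_eq_zero (h : IsTridiagonalData A E θ As Es θs)
    (hR : ∀ i, ∀ v ∈ splitSpace E Es i, R v = A v - θ i • v) {i n : ℕ} {v : V} (hi : 2 * i ≤ d)
    (hv : v ∈ kerSpace E Es i) (hn : d < 2 * i + n) : (R ^ n) v = 0 := by
  obtain ⟨m, rfl⟩ := Nat.exists_eq_add_of_le (show d - 2 * i + 1 ≤ n by omega)
  rw [add_comm, pow_add, Module.End.mul_apply, ((h.mem_kerSpace_iff hR hi).mp hv).2, map_zero]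

/-- The sum of the spaces `R^k K_j`, for `2j + k ≤ d`, is direct, and `R^k` is injective on `K_j`
for these `j` and `k`. -/
theorem pow_raising_independent (h : IsTridiagonalData A E θ As Es θs)
    (hR : ∀ i, ∀ v ∈ splitSpace E Es i, R v = A v - θ i • v)
    (v : Fin (d + 1) × Fin (d + 1) → V)
    (hv : ∀ p, v p ∈ if 2 * (p.1 : ℕ) + p.2 ≤ d then kerSpace E Es p.1 else ⊥)
    (hsum : ∑ p, (R ^ (p.2 : ℕ)) (v p) = 0) (p : Fin (d + 1) × Fin (d + 1)) : v p = 0 := by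
  have hv0 : ∀ p, ¬ 2 * (p.1 : ℕ) + p.2 ≤ d → v p = 0 := fun p hp => by
    have := hv p
    rwa [if_neg hp] at this
  have hvk : ∀ p, 2 * (p.1 : ℕ) + p.2 ≤ d → v p ∈ kerSpace E Es p.1 := fun p hp => by
    have := hv p
    rwa [if_pos hp] at this
  have hdeg : ∀ i : Fin (d + 1),
      ∑ p : Fin (d + 1) × Fin (d + 1),
        (if (p.1 : ℕ) + p.2 = i then (R ^ (p.2 : ℕ)) (v p) else 0) = 0 := by
    refine h.splitSpace_independent _ (fun i => Submodule.sum_mem _ fun p _ => ?_) ?_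
    · split_ifs with hp
      · by_cases hle : 2 * (p.1 : ℕ) + p.2 ≤ d
        · rw [← hp]
          exact h.pow_raising_mem hR
            ((h.mem_kerSpace_iff hR (by omega)).mp (hvk p hle)).1 _
        · rw [hv0 p hle, map_zero]
          exact Submodule.zero_mem _
      · exact Submodule.zero_mem _
    · rw [Finset.sum_comm]
      refine Eq.trans ?_ hsum
      refine Finset.sum_congr rfl fun p _ => ?_
      by_cases hle : 2 * (p.1 : ℕ) + p.2 ≤ d
      · rw [Finset.sum_eq_single ⟨(p.1 : ℕ) + p.2, by omega⟩]
        · rw [if_pos rfl]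
        · intro i _ hi
          rw [if_neg fun e => hi (Fin.ext e.symm)]
        · simp
      · rw [hv0 p hle, map_zero]
        simp
  obtain ⟨j, k⟩ := p
  induction j using WellFoundedLT.induction generalizing k with
  | ind j ih =>
    by_cases hjk : 2 * (j : ℕ) + k ≤ d
    swap
    · exact hv0 _ hjk
    -- In degree `j + k`, the power `R^{d-2j-k}` kills the terms from `K_{j'}` with `j' > j`.
    have key := congrArg (R ^ (d - 2 * j - k)) (hdeg ⟨j + k, by omega⟩)
    rw [map_sum, map_zero, Finset.sum_eq_single (j, k)] at key
    · rw [if_pos rfl, ← Module.End.mul_apply, ← pow_add,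
        show d - 2 * j - k + k = d - 2 * (j : ℕ) by omega] at key
      have hj : 2 * (j : ℕ) ≤ d := by omega
      have hm : v (j, k) ∈ kerSpace E Es j := hvk (j, k) hjk
      exact h.eq_zero_of_pow_raising hR hj ((h.mem_kerSpace_iff hR hj).mp hm).1 key
    · rintro ⟨j', k'⟩ _ hne
      split_ifs with hp
      · obtain hlt | rfl | hlt := lt_trichotomy j' j
        · rw [ih j' hlt, map_zero, map_zero]
        · have hk : k' = k := Fin.ext (Nat.add_left_cancel hp)
          exact absurd (by rw [hk]) hne
        · have hlt' : (j : ℕ) < j' := hlt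
          by_cases hle : 2 * (j' : ℕ) + k' ≤ d
          · simp only at hp
            rw [← Module.End.mul_apply, ← pow_add]
            have hj' : 2 * (j' : ℕ) ≤ d := by omega
            have hm : v (j', k') ∈ kerSpace E Es j' := hvk (j', k') hle
            exact h.pow_raising_eq_zero hR hj' hm
              (show d < 2 * (j' : ℕ) + (d - 2 * j - k + k') by omega)
          · rw [hv0 _ hle, map_zero, map_zero]
      · exact map_zero _
    · simp

theorem exists_lowering (h : IsTridiagonalData A E θ As Es θs)
    (hR : ∀ i, ∀ v ∈ splitSpace E Es i, R v = A v - θ i • v) (c : ℕ → ℕ → 𝕂)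
    (hc : ∀ i, 2 * i ≤ d → c i (d - 2 * i + 1) = 0) :
    ∃ X : Module.End 𝕂 V, ∀ i, 2 * i ≤ d → ∀ v ∈ kerSpace E Es i, ∀ n,
      X ((R ^ n) v) = c i n • (R ^ (n - 1)) v := by
  obtain ⟨X, hX⟩ := exists_end_of_independent
    (fun p : Fin (d + 1) × Fin (d + 1) =>
      if 2 * (p.1 : ℕ) + p.2 ≤ d then kerSpace E Es p.1 else ⊥)
    (fun p => R ^ (p.2 : ℕ)) (fun p => c p.1 p.2 • R ^ ((p.2 : ℕ) - 1))
    (h.pow_raising_independent hR)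
  refine ⟨X, fun i hi v hv n => ?_⟩
  obtain hn | hn := le_or_gt (2 * i + n) d
  · exact hX (⟨i, by omega⟩, ⟨n, by omega⟩) v (by rwa [if_pos hn])
  · rw [h.pow_raising_eq_zero hR hi hv hn, map_zero]
    obtain rfl | hn' := eq_or_ne n (d - 2 * i + 1)
    · rw [hc i hi, zero_smul]
    · rw [h.pow_raising_eq_zero hR hi hv (by omega), smul_zero]

end IsTridiagonalData

end Raising

/-! ### The operators `K` and `ψ` -/

section QRacah

variable {𝕂 V : Type*} [Field 𝕂] [AddCommGroup V] [Module 𝕂 V] {d : ℕ}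

theorem units_inv_apply_of_apply_eq_smul (K : (Module.End 𝕂 V)ˣ) {c : 𝕂} {v : V} (hc : c ≠ 0)
    (hv : (K : Module.End 𝕂 V) v = c • v) :
    ((K⁻¹ : (Module.End 𝕂 V)ˣ) : Module.End 𝕂 V) v = c⁻¹ • v := by
  have h1 := LinearMap.congr_fun K.inv_mul v
  rw [Module.End.mul_apply, hv, map_smul, Module.End.one_apply] at h1
  rw [← h1, inv_smul_smul₀ hc, h1]

/-- An eigenvector of `B` with eigenvalue `l` is mapped by `A - (a⁻¹ l + a l⁻¹)` to an eigenvector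
with eigenvalue `q⁻² l`. -/
theorem apply_raised_eigenvector {q a l : 𝕂} (hq : q ≠ 0) (hl : l ≠ 0)
    {A B : Module.End 𝕂 V} (hAB : q • (B * A) - q⁻¹ • (A * B) =
      (q - q⁻¹) • (a⁻¹ • (B * B) + a • 1)) {x : V} (hx : B x = l • x) :
    B (A x - (a⁻¹ * l + a * l⁻¹) • x) =
      ((q ^ 2)⁻¹ * l) • (A x - (a⁻¹ * l + a * l⁻¹) • x) := by
  have h1 := LinearMap.congr_fun hAB x
  simp only [LinearMap.sub_apply, LinearMap.smul_apply, LinearMap.add_apply, Module.End.mul_apply,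
    Module.End.one_apply, hx, map_smul] at h1
  have h2 : B (A x) = q⁻¹ • (q⁻¹ • l • A x +
      (q - q⁻¹) • (a⁻¹ • l • l • x + a • x)) := by
    rw [← h1, add_sub_cancel, inv_smul_smul₀ hq]
  rw [map_sub, map_smul, hx, h2]
  match_scalars
  · field_simp
  · field_simp
    ring

/-- The sequence `a q^{d-2n} + a⁻¹ q^{2n-d}`. -/
def racahSeq (d : ℕ) (q a : 𝕂) (n : ℕ) : 𝕂 :=
  a * q ^ ((d : ℤ) - 2 * (n : ℤ)) + a⁻¹ * q ^ (2 * (n : ℤ) - (d : ℤ))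

theorem racahSeq_sub (q a : 𝕂) {n : ℕ} (hn : n ≤ d) :
    racahSeq d q a (d - n) = racahSeq d q a⁻¹ n := by
  rw [racahSeq, racahSeq, inv_inv, add_comm, Nat.cast_sub hn]
  congr 3 <;> ring

/-- The scalars with `ψ R^n v = c_{i,n} R^{n-1} v` for `v ∈ K_i`. -/
def loweringCoeff (d : ℕ) (q : 𝕂) (i n : ℕ) : 𝕂 :=
  (q ^ (n : ℤ) - q ^ (-(n : ℤ))) *
    (q ^ ((d : ℤ) - 2 * i - n + 1) - q ^ (-((d : ℤ) - 2 * i - n + 1)))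

theorem loweringCoeff_zero (q : 𝕂) (i : ℕ) : loweringCoeff d q i 0 = 0 := by
  simp [loweringCoeff]

theorem loweringCoeff_top (q : 𝕂) {i : ℕ} (hi : 2 * i ≤ d) :
    loweringCoeff d q i (d - 2 * i + 1) = 0 := by
  have : (d : ℤ) - 2 * i - ((d - 2 * i + 1 : ℕ) : ℤ) + 1 = 0 := by omega
  rw [loweringCoeff, this, neg_zero, sub_self, mul_zero]

theorem loweringCoeff_succ_sub {q : 𝕂} (hq : q ≠ 0) (i n : ℕ) :
    loweringCoeff d q i (n + 1) - loweringCoeff d q i n =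
      (q - q⁻¹) * (q ^ ((d : ℤ) - 2 * (i + n : ℕ)) - (q ^ ((d : ℤ) - 2 * (i + n : ℕ)))⁻¹) := by
  have e : ((d : ℤ) - 2 * (i + n : ℕ)) = ((d : ℤ) - 2 * i) - n - n := by push_cast; ring
  rw [loweringCoeff, loweringCoeff, e]
  generalize (d : ℤ) - 2 * i = m
  push_cast
  have hm : q ^ m ≠ 0 := zpow_ne_zero _ hq
  have hn : q ^ (n : ℤ) ≠ 0 := zpow_ne_zero _ hq
  simp only [zpow_neg, zpow_add₀ hq, zpow_sub₀ hq, zpow_one]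
  generalize q ^ m = y at *
  generalize q ^ (n : ℤ) = x at *
  field_simp
  ring

namespace IsTridiagonalData

variable {A As : Module.End 𝕂 V} {E Es : Fin (d + 1) → Module.End 𝕂 V} {θ θs : ℕ → 𝕂}
  {q a : 𝕂}

theorem exists_unit_diag (h : IsTridiagonalData A E θ As Es θs) {c : ℕ → 𝕂}
    (hc : ∀ i, c i ≠ 0) :
    ∃ K : (Module.End 𝕂 V)ˣ, ∀ i, ∀ v ∈ splitSpace E Es i, (K : Module.End 𝕂 V) v = c i • v := by
  obtain ⟨X, hX⟩ := h.exists_diag c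
  obtain ⟨Y, hY⟩ := h.exists_diag fun i => (c i)⁻¹
  refine ⟨⟨X, Y, h.ext_splitSpace fun i _ v hv => ?_, h.ext_splitSpace fun i _ v hv => ?_⟩, hX⟩
  · rw [Module.End.mul_apply, hY i v hv, map_smul, hX i v hv, inv_smul_smul₀ (hc i),
      Module.End.one_apply]
  · rw [Module.End.mul_apply, hX i v hv, map_smul, hY i v hv, smul_inv_smul₀ (hc i),
      Module.End.one_apply]

theorem raising_apply (h : IsTridiagonalData A E θ As Es θs) (hq : q ≠ 0)
    (hθ : ∀ n ≤ d, θ n = racahSeq d q a n) {K : (Module.End 𝕂 V)ˣ}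
    (hK : ∀ i, ∀ v ∈ splitSpace E Es i,
      (K : Module.End 𝕂 V) v = q ^ ((d : ℤ) - 2 * (i : ℤ)) • v) :
    ∀ i, ∀ v ∈ splitSpace E Es i,
      (A - a • (K : Module.End 𝕂 V) - a⁻¹ • ((K⁻¹ : (Module.End 𝕂 V)ˣ) : Module.End 𝕂 V)) v =
        A v - θ i • v := by
  intro i v hv
  obtain hi | hi := le_or_gt i d
  · rw [LinearMap.sub_apply, LinearMap.sub_apply, LinearMap.smul_apply, LinearMap.smul_apply,
      units_inv_apply_of_apply_eq_smul K (zpow_ne_zero _ hq) (hK i v hv), hK i v hv, hθ i hi,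
      racahSeq, ← zpow_neg, neg_sub]
    module
  · rw [h.splitSpace_eq_bot hi, Submodule.mem_bot] at hv
    rw [hv, map_zero, map_zero, smul_zero, sub_zero]

theorem apply_pow_raising {R : Module.End 𝕂 V} (h : IsTridiagonalData A E θ As Es θs)
    (hR : ∀ i, ∀ v ∈ splitSpace E Es i, R v = A v - θ i • v) {K : (Module.End 𝕂 V)ˣ}
    (hK : ∀ i, ∀ v ∈ splitSpace E Es i,
      (K : Module.End 𝕂 V) v = q ^ ((d : ℤ) - 2 * (i : ℤ)) • v)
    {i : ℕ} (hi : 2 * i ≤ d) {v : V} (hv : v ∈ kerSpace E Es i) (n : ℕ) :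
    (K : Module.End 𝕂 V) ((R ^ n) v) = q ^ ((d : ℤ) - 2 * (i + n : ℕ)) • (R ^ n) v :=
  hK _ _ (h.pow_raising_mem hR ((h.mem_kerSpace_iff hR hi).mp hv).1 n)

theorem raising_mul {R : Module.End 𝕂 V} (h : IsTridiagonalData A E θ As Es θs) (hq : q ≠ 0)
    (hR : ∀ i, ∀ v ∈ splitSpace E Es i, R v = A v - θ i • v) {K : (Module.End 𝕂 V)ˣ}
    (hK : ∀ i, ∀ v ∈ splitSpace E Es i,
      (K : Module.End 𝕂 V) v = q ^ ((d : ℤ) - 2 * (i : ℤ)) • v) :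
    R * (K : Module.End 𝕂 V) = q ^ 2 • ((K : Module.End 𝕂 V) * R) := by
  refine h.ext_splitSpace fun i _ v hv => ?_
  rw [Module.End.mul_apply, LinearMap.smul_apply, Module.End.mul_apply, hK i v hv,
    hK _ _ (h.raising_mem hR hv), map_smul, smul_smul, ← zpow_natCast, ← zpow_add₀ hq]
  congr 2
  push_cast
  ring

/-- Existence and uniqueness of the double lowering operator, with its commutation relation with
`K`; it is nilpotent because it lowers the degree in the split decomposition. -/
theorem exists_doubleLowering {R : Module.End 𝕂 V} (h : IsTridiagonalData A E θ As Es θs)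
    (hq : q ≠ 0) (hR : ∀ i, ∀ v ∈ splitSpace E Es i, R v = A v - θ i • v)
    {K : (Module.End 𝕂 V)ˣ}
    (hK : ∀ i, ∀ v ∈ splitSpace E Es i,
      (K : Module.End 𝕂 V) v = q ^ ((d : ℤ) - 2 * (i : ℤ)) • v) :
    ∃ ψ : Module.End 𝕂 V, (∀ X : Module.End 𝕂 V,
      (X * R - R * X = (q - q⁻¹) •
          ((K : Module.End 𝕂 V) - ((K⁻¹ : (Module.End 𝕂 V)ˣ) : Module.End 𝕂 V)) ∧
        ∀ i, 2 * i ≤ d → ∀ v ∈ kerSpace E Es i, X v = 0) ↔ X = ψ) ∧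
      (K : Module.End 𝕂 V) * ψ = q ^ 2 • (ψ * (K : Module.End 𝕂 V)) ∧ IsNilpotent ψ := by
  obtain ⟨ψ, hψ⟩ := h.exists_lowering hR (loweringCoeff d q) fun i hi => loweringCoeff_top q hi
  have hψ0 : ∀ i, 2 * i ≤ d → ∀ v ∈ kerSpace E Es i, ψ v = 0 := fun i hi v hv => by
    have := hψ i hi v hv 0
    rwa [loweringCoeff_zero, zero_smul] at this
  have hψR : ψ * R - R * ψ = (q - q⁻¹) •
      ((K : Module.End 𝕂 V) - ((K⁻¹ : (Module.End 𝕂 V)ˣ) : Module.End 𝕂 V)) := by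
    refine h.ext_pow_raising hR fun i hi v hv n => ?_
    have hKn := h.apply_pow_raising hR hK hi hv n
    have e1 : ψ (R ((R ^ n) v)) = loweringCoeff d q i (n + 1) • (R ^ n) v := by
      have := hψ i hi v hv (n + 1)
      rwa [Nat.add_sub_cancel, pow_succ', Module.End.mul_apply] at this
    have e2 : R (ψ ((R ^ n) v)) = loweringCoeff d q i n • (R ^ n) v := by
      rw [hψ i hi v hv, map_smul]
      obtain _ | n := n
      · rw [loweringCoeff_zero, zero_smul, zero_smul]
      · rw [Nat.add_sub_cancel, ← Module.End.mul_apply, ← pow_succ']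
    rw [LinearMap.sub_apply, Module.End.mul_apply, Module.End.mul_apply, e1, e2, ← sub_smul,
      loweringCoeff_succ_sub hq, LinearMap.smul_apply, LinearMap.sub_apply, hKn,
      units_inv_apply_of_apply_eq_smul K (zpow_ne_zero _ hq) hKn, ← sub_smul, smul_smul]
  refine ⟨ψ, fun X => ⟨fun hX => ?_, fun hX => hX ▸ ⟨hψR, hψ0⟩⟩, ?_, d + 1, ?_⟩
  · refine LinearMap.eqLocus_eq_top.mp (h.eq_top_of_raising_invariant hR (fun v hv => ?_)
      fun i hi v hv => (hX.2 i hi v hv).trans (hψ0 i hi v hv).symm)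
    rw [LinearMap.mem_eqLocus] at hv ⊢
    have := LinearMap.congr_fun (hX.1.trans hψR.symm) v
    simp only [LinearMap.sub_apply, Module.End.mul_apply, hv] at this
    exact sub_left_injective this
  · refine h.ext_pow_raising hR fun i hi v hv n => ?_
    rw [Module.End.mul_apply, LinearMap.smul_apply, Module.End.mul_apply, hψ i hi v hv,
      h.apply_pow_raising hR hK hi hv, map_smul, map_smul, hψ i hi v hv]
    obtain _ | n := n
    · simp only [loweringCoeff_zero, zero_smul, smul_zero]
    · rw [Nat.add_sub_cancel, h.apply_pow_raising hR hK hi hv, smul_smul, smul_smul, smul_smul]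
      congr 1
      rw [show (d : ℤ) - 2 * (i + n : ℕ) = 2 + ((d : ℤ) - 2 * (i + (n + 1) : ℕ)) by
        push_cast; ring, zpow_add₀ hq, zpow_ofNat]
      ring
  · have hpow : ∀ i, 2 * i ≤ d → ∀ v ∈ kerSpace E Es i, ∀ n, (ψ ^ (n + 1)) ((R ^ n) v) = 0 := by
      intro i hi v hv n
      induction n with
      | zero =>
        rw [zero_add, pow_one]
        exact hψ0 i hi v hv
      | succ n ih =>
        rw [pow_succ, Module.End.mul_apply, hψ i hi v hv, map_smul, Nat.add_sub_cancel, ih,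
          smul_zero]
    refine h.ext_pow_raising hR fun i hi v hv n => ?_
    rw [LinearMap.zero_apply]
    obtain hn | hn := le_or_gt n d
    · obtain ⟨m, hm⟩ := Nat.exists_eq_add_of_le' hn
      rw [hm, add_assoc, pow_add, Module.End.mul_apply, hpow i hi v hv, map_zero]
    · rw [h.pow_raising_eq_zero hR hi hv (by omega), map_zero]

/-- The relation `B = (1 - a⁻¹ q ψ)⁻¹ (1 - a q ψ) K`, multiplied out on either side. The right-hand side satisfies the same
`q`-commutation relation with `A` as `B` does, and it agrees with `B` on the spaces `K_i`, which
generate `V` under the raising map of the reversed system. -/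
theorem mul_eq_mul (h : IsTridiagonalData A E θ As Es θs) (hq : q ≠ 0) (ha : a ≠ 0)
    (hθ : ∀ n ≤ d, θ n = racahSeq d q a n) {K B : (Module.End 𝕂 V)ˣ} {ψ : Module.End 𝕂 V}
    (hK : ∀ i, ∀ v ∈ splitSpace E Es i,
      (K : Module.End 𝕂 V) v = q ^ ((d : ℤ) - 2 * (i : ℤ)) • v)
    (hB : ∀ i, ∀ v ∈ splitSpace (fun j => E j.rev) Es i,
      (B : Module.End 𝕂 V) v = q ^ ((d : ℤ) - 2 * (i : ℤ)) • v)
    (hψR : ψ * (A - a • (K : Module.End 𝕂 V) -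
        a⁻¹ • ((K⁻¹ : (Module.End 𝕂 V)ˣ) : Module.End 𝕂 V)) -
      (A - a • (K : Module.End 𝕂 V) -
        a⁻¹ • ((K⁻¹ : (Module.End 𝕂 V)ˣ) : Module.End 𝕂 V)) * ψ =
      (q - q⁻¹) • ((K : Module.End 𝕂 V) - ((K⁻¹ : (Module.End 𝕂 V)ˣ) : Module.End 𝕂 V)))
    (hψ0 : ∀ i, 2 * i ≤ d → ∀ v ∈ kerSpace E Es i, ψ v = 0)
    (hKψ : (K : Module.End 𝕂 V) * ψ = q ^ 2 • (ψ * (K : Module.End 𝕂 V)))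
    (hnil : IsNilpotent ψ) :
    (1 - (a⁻¹ * q) • ψ) * (B : Module.End 𝕂 V) = (1 - (a * q) • ψ) * (K : Module.End 𝕂 V) ∧
      (B : Module.End 𝕂 V) * (1 - (a⁻¹ * q⁻¹) • ψ) =
        (1 - (a * q) • ψ) * (K : Module.End 𝕂 V) := by
  obtain ⟨P, hP⟩ : IsUnit (1 - (a⁻¹ * q) • ψ) := (hnil.smul _).isUnit_one_sub
  obtain ⟨Q, hQ⟩ : IsUnit (1 - (a⁻¹ * q⁻¹) • ψ) := (hnil.smul _).isUnit_one_sub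
  have hR := h.raising_apply hq hθ hK
  have hR' := h.rev.raising_apply (a := a⁻¹) hq
    (fun n hn => (hθ _ (Nat.sub_le d n)).trans (racahSeq_sub q a hn)) hB
  rw [inv_inv] at hR'
  have hrel := cleared_relation (A := A) hq ha K.mul_inv K.inv_mul (by abel)
    (h.raising_mul hq hR hK) hKψ hψR
  have hKQ : (K : Module.End 𝕂 V) * (1 - (a⁻¹ * q⁻¹) • ψ) =
      (1 - (a⁻¹ * q) • ψ) * (K : Module.End 𝕂 V) := by
    rw [mul_sub, sub_mul, mul_smul_comm, hKψ, smul_mul_assoc, smul_smul, mul_one, one_mul]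
    congr 2
    field_simp
  have hPS : (1 - (a * q) • ψ) * (1 - (a⁻¹ * q) • ψ) =
      (1 - (a⁻¹ * q) • ψ) * (1 - (a * q) • ψ) := by
    simp only [mul_sub, sub_mul, one_mul, mul_one, smul_mul_assoc, mul_smul_comm]
    module
  set S : Module.End 𝕂 V := 1 - (a * q) • ψ with hS
  rw [← hP, ← hQ] at hrel
  rw [← hP] at hPS hKQ ⊢
  rw [← hQ] at hKQ ⊢
  set C : Module.End 𝕂 V := ((P⁻¹ : (Module.End 𝕂 V)ˣ) : Module.End 𝕂 V) * S * K with hC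
  have hPC : (P : Module.End 𝕂 V) * C = S * K := by
    rw [hC, mul_assoc, Units.mul_inv_cancel_left]
  have hCQ : C * (Q : Module.End 𝕂 V) = S * K := by
    rw [hC, mul_assoc, hKQ, ← mul_assoc, mul_assoc _ S, hPS, Units.inv_mul_cancel_left]
  have hAC : q • (C * A) - q⁻¹ • (A * C) = (q - q⁻¹) • (a⁻¹ • (C * C) + a • 1) := by
    refine P.isUnit.mul_left_cancel (Q.isUnit.mul_right_cancel ?_)
    simp only [mul_add, add_mul, mul_sub, sub_mul, smul_mul_assoc, mul_smul_comm, mul_one]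
    rw [← mul_assoc _ C A, hPC, ← mul_assoc _ A C, mul_assoc _ C _, hCQ, ← mul_assoc _ C C, hPC,
      mul_assoc _ C _, hCQ, hrel, smul_add]
  have hfix : ∀ i, 2 * i ≤ d → ∀ v ∈ kerSpace E Es i,
      C v = q ^ ((d : ℤ) - 2 * (i + 0 : ℕ)) • v := by
    intro i hi v hv
    have hPv : (P : Module.End 𝕂 V) v = v := by
      rw [hP, LinearMap.sub_apply, LinearMap.smul_apply, hψ0 i hi v hv, smul_zero, sub_zero,
        Module.End.one_apply]
    have hPv' := units_inv_apply_of_apply_eq_smul P one_ne_zero (by rw [hPv, one_smul])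
    rw [hC, Module.End.mul_apply, Module.End.mul_apply,
      hK i v ((h.mem_kerSpace_iff hR hi).mp hv).1, map_smul, hS, LinearMap.sub_apply,
      LinearMap.smul_apply, hψ0 i hi v hv, smul_zero, sub_zero, Module.End.one_apply, map_smul,
      hPv', inv_one, one_smul, add_zero]
  clear_value C
  have hBC : (B : Module.End 𝕂 V) = C := by
    refine h.rev.ext_pow_raising hR' fun i hi v hv n => ?_
    rw [h.rev.apply_pow_raising hR' hB hi hv]
    symm
    induction n with
    | zero => exact hfix i hi v (by rwa [h.kerSpace_rev] at hv)
    | succ n ih =>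
      have hBn := h.rev.apply_pow_raising hR' hB hi hv n
      have := apply_raised_eigenvector hq (zpow_ne_zero _ hq) hAC ih
      rw [pow_succ', Module.End.mul_apply, LinearMap.sub_apply, LinearMap.sub_apply,
        LinearMap.smul_apply, LinearMap.smul_apply, hBn,
        units_inv_apply_of_apply_eq_smul B (zpow_ne_zero _ hq) hBn, smul_smul, smul_smul,
        sub_sub, ← add_smul, this]
      congr 1
      rw [show (d : ℤ) - 2 * (i + n : ℕ) = 2 + ((d : ℤ) - 2 * (i + (n + 1) : ℕ)) by
        push_cast; ring, zpow_add₀ hq, zpow_ofNat, inv_mul_cancel_left₀ (pow_ne_zero _ hq)]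
  rw [hBC]
  exact ⟨hPC, hCQ⟩

end IsTridiagonalData

end QRacah

/-! ### Tridiagonal systems -/

namespace TDSystem

theorem isTridiagonalResolution {𝕂 V : Type*} [Field 𝕂] [AddCommGroup V] [Module 𝕂 V] {d : ℕ}
    {A A' : Module.End 𝕂 V} {E : Fin (d + 1) → Module.End 𝕂 V} {θ : ℕ → 𝕂}
    (hdiag : ⨆ t : 𝕂, Module.End.eigenspace A t = ⊤) (hE : IsStandardIdempotentOrdering A A' E)
    (hθ : ∀ i : Fin (d + 1), LinearMap.range (E i) = Module.End.eigenspace A (θ i)) :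
    IsTridiagonalResolution A A' E θ := by
  obtain ⟨⟨⟨-, heig⟩, htri⟩, hidem, horth⟩ := hE
  have happ : ∀ i j, i ≠ j → ∀ v, E i (E j v) = 0 := fun i j hij v =>
    LinearMap.congr_fun (horth i j hij) v
  have hsum : ∑ j, E j = 1 := by
    refine LinearMap.eqLocus_eq_top.mp (top_le_iff.mp (hdiag ▸ iSup_le fun t => ?_))
    by_cases hb : Module.End.eigenspace A t = ⊥
    · rw [hb]
      exact bot_le
    · obtain ⟨i, hi⟩ := (heig _).mpr ⟨hb, t, rfl⟩
      rw [← hi]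
      rintro _ ⟨v, rfl⟩
      rw [LinearMap.mem_eqLocus, LinearMap.sum_apply, Finset.sum_eq_single i]
      · exact LinearMap.congr_fun (hidem i) v
      · exact fun j _ hj => happ j i hj v
      · simp
  have hAE : ∀ j : Fin (d + 1), ∀ v, A (E j v) = θ j • E j v := fun j v =>
    Module.End.mem_eigenspace_iff.mp (hθ j ▸ LinearMap.mem_range_self (E j) v)
  refine ⟨hsum, hidem, horth, fun j => ?_, fun i j hij => ?_, fun j hj => ?_⟩
  · calc E j * A = ∑ i, E j * (A * E i) := by
          rw [← Finset.mul_sum, ← Finset.mul_sum, hsum, mul_one]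
      _ = ∑ i : Fin (d + 1), θ i • (E j * E i) := Finset.sum_congr rfl fun i _ => by
          rw [show A * E i = θ i • E i from LinearMap.ext (hAE i), mul_smul_comm]
      _ = θ j • E j := by
          rw [Finset.sum_eq_single j, hidem]
          · exact fun i _ hi => by rw [horth j i hi.symm, smul_zero]
          · simp
  · refine LinearMap.ext fun v => ?_
    have hle : (⨆ k : Fin (d + 1), ⨆ _ : (k : ℕ) ≤ i + 1 ∧ (i : ℕ) ≤ k + 1,
        LinearMap.range (E k)) ≤ LinearMap.ker (E j) := by
      refine iSup_le fun k => iSup_le fun hk => ?_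
      rintro _ ⟨w, rfl⟩
      exact happ j k (by rintro rfl; exact hij hk) w
    exact hle (htri i ⟨E i v, ⟨v, rfl⟩, rfl⟩)
  · exact ((heig _).mp ⟨j, rfl⟩).1 (LinearMap.range_eq_bot.mpr hj)

variable {𝕂 V : Type*} [Field 𝕂] [AddCommGroup V] [Module 𝕂 V] {d : ℕ} {Φ : TDSystem 𝕂 V d}
  {q a b : 𝕂}

theorem IsQRacah.isTridiagonalData (hΦ : Φ.IsQRacah q a b) :
    IsTridiagonalData Φ.A Φ.E (racahSeq d q a) Φ.Astar Φ.Estar (racahSeq d q b) where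
  res := isTridiagonalResolution Φ.isTridiagonalPair.diagonalizable Φ.standard hΦ.eigenvalue
  resStar :=
    isTridiagonalResolution Φ.isTridiagonalPair.diagonalizable' Φ.standardStar hΦ.eigenvalueStar
  inj i j hi hj hij := by
    have h : LinearMap.range (Φ.E ⟨i, by omega⟩) = LinearMap.range (Φ.E ⟨j, by omega⟩) :=
      (hΦ.eigenvalue ⟨i, by omega⟩).trans
        ((congrArg (Module.End.eigenspace Φ.A) hij).trans (hΦ.eigenvalue ⟨j, by omega⟩).symm)
    exact congrArg Fin.val (Φ.standard.1.1.1 h)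
  irreducible W hA hAs := Φ.isTridiagonalPair.irreducible W
    (Submodule.map_le_iff_le_comap.mpr hA) (Submodule.map_le_iff_le_comap.mpr hAs)

theorem IsQRacah.splitSpace_rev_eq_Udd (hΦ : Φ.IsQRacah q a b) (i : Fin (d + 1)) :
    splitSpace (fun j => Φ.E j.rev) Φ.Estar i = Φ.Udd i := by
  have h := hΦ.isTridiagonalData.res
  have hi := i.2
  rw [splitSpace, h.specSum_rev]
  exact congrArg _ (le_antisymm
    (h.specSum_mono (r := fun j => j + (i : ℕ) ≤ d) fun j _ _ => by omega)
    (h.specSum_mono (p := fun j => j + (i : ℕ) ≤ d) fun j _ _ => by omega))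

end TDSystem

theorem proposition9p2 {𝕂 V : Type*} [Field 𝕂] [IsAlgClosed 𝕂] [AddCommGroup V] [Module 𝕂 V]
    [FiniteDimensional 𝕂 V] [Nontrivial V] {d : ℕ} (hd : 1 ≤ d)
    (Φ : TDSystem 𝕂 V d) (q a b : 𝕂) (hΦ : Φ.IsQRacah q a b) :
    ∃ (K B : (Module.End 𝕂 V)ˣ) (ψ : Module.End 𝕂 V),
      (∀ X : Module.End 𝕂 V, Φ.IsK q X ↔ X = K) ∧
      (∀ X : Module.End 𝕂 V, Φ.IsB q X ↔ X = B) ∧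
      (∀ X : Module.End 𝕂 V, Φ.IsDoubleLowering q a K X ↔ X = ψ) ∧
      ((1 - (a * q) • ψ) * (K : Module.End 𝕂 V) = (1 - (a⁻¹ * q) • ψ) * (B : Module.End 𝕂 V) ∧
        (1 - (a * q) • ψ) * (K : Module.End 𝕂 V) = (K : Module.End 𝕂 V) * (1 - (a * q⁻¹) • ψ) ∧
        (1 - (a * q) • ψ) * (K : Module.End 𝕂 V) =
          (B : Module.End 𝕂 V) * (1 - (a⁻¹ * q⁻¹) • ψ)) ∧
      ((1 - (a⁻¹ * q⁻¹) • ψ) * ((K⁻¹ : (Module.End 𝕂 V)ˣ) : Module.End 𝕂 V) =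
          (1 - (a * q⁻¹) • ψ) * ((B⁻¹ : (Module.End 𝕂 V)ˣ) : Module.End 𝕂 V) ∧
        (1 - (a⁻¹ * q⁻¹) • ψ) * ((K⁻¹ : (Module.End 𝕂 V)ˣ) : Module.End 𝕂 V) =
          ((K⁻¹ : (Module.End 𝕂 V)ˣ) : Module.End 𝕂 V) * (1 - (a⁻¹ * q) • ψ) ∧
        (1 - (a⁻¹ * q⁻¹) • ψ) * ((K⁻¹ : (Module.End 𝕂 V)ˣ) : Module.End 𝕂 V) =
          ((B⁻¹ : (Module.End 𝕂 V)ˣ) : Module.End 𝕂 V) * (1 - (a * q) • ψ)) := by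
  have hq := hΦ.q_ne_zero
  have ha := hΦ.a_ne_zero
  have h := hΦ.isTridiagonalData
  have hθ : ∀ n ≤ d, racahSeq d q a n = racahSeq d q a n := fun _ _ => rfl
  have hc : ∀ i : ℕ, q ^ ((d : ℤ) - 2 * (i : ℤ)) ≠ 0 := fun i => zpow_ne_zero _ hq
  obtain ⟨K, hK⟩ := h.exists_unit_diag hc
  obtain ⟨B, hB⟩ := h.rev.exists_unit_diag hc
  have hR := h.raising_apply hq hθ hK
  obtain ⟨ψ, hψ, hKψ, hnil⟩ := h.exists_doubleLowering hq hR hK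
  obtain ⟨hψR, hψ0⟩ := (hψ ψ).mpr rfl
  obtain ⟨hPB, hBQ⟩ := h.mul_eq_mul hq ha hθ hK hB hψR hψ0 hKψ hnil
  -- Moving `K` past a polynomial in `ψ`.
  have hcomm : ∀ c e : 𝕂, c = e * q ^ 2 →
      (K : Module.End 𝕂 V) * (1 - e • ψ) = (1 - c • ψ) * (K : Module.End 𝕂 V) := by
    rintro c e rfl
    rw [mul_sub, sub_mul, mul_smul_comm, hKψ, smul_mul_assoc, smul_smul, mul_one, one_mul]
  have hKS := hcomm (a * q) (a * q⁻¹) (by field_simp)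
  have hKQ := hcomm (a⁻¹ * q) (a⁻¹ * q⁻¹) (by field_simp)
  have hQK : (1 - (a⁻¹ * q⁻¹) • ψ) * ((K⁻¹ : (Module.End 𝕂 V)ˣ) : Module.End 𝕂 V) =
      ((K⁻¹ : (Module.End 𝕂 V)ˣ) : Module.End 𝕂 V) * (1 - (a⁻¹ * q) • ψ) := by
    rw [Units.mul_inv_eq_iff_eq_mul, mul_assoc, ← hKQ, Units.inv_mul_cancel_left]
  refine ⟨K, B, ψ, fun X => ⟨fun hX => ?_, ?_⟩, fun X => ⟨fun hX => ?_, ?_⟩, fun X => ?_,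
    ⟨hPB.symm, hKS.symm, hBQ.symm⟩, ?_, hQK, ?_⟩
  · refine h.ext_splitSpace fun i hi v hv => ?_
    rw [hK i v hv]
    exact hX ⟨i, by omega⟩ v hv
  · rintro rfl i v hv
    exact hK i v hv
  · refine h.rev.ext_splitSpace fun i hi v hv => ?_
    rw [hB i v hv]
    exact hX ⟨i, by omega⟩ v (hΦ.splitSpace_rev_eq_Udd ⟨i, by omega⟩ ▸ hv)
  · rintro rfl i v hv
    exact hB i v (hΦ.splitSpace_rev_eq_Udd i ▸ hv)
  · rw [← hψ X]
    exact and_congr Iff.rfl ⟨fun hX i hi => hX ⟨i, by omega⟩ hi, fun hX i => hX i⟩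
  · rw [hQK, eq_comm, Units.mul_inv_eq_iff_eq_mul, mul_assoc, hPB, ← hKS,
      Units.inv_mul_cancel_left]
  · rw [Units.mul_inv_eq_iff_eq_mul, mul_assoc, ← hBQ, Units.inv_mul_cancel_left]
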